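/- A dyadic partition of the unit square is a set of open rectangles obtained from $\{(0,1)^2\}$ by a finite sequence of steps, each of which chooses a rectangle $R=(a_1,b_1)\times(a_2,b_2)$ of the current set and a direction $i\in\{1,2\}$, and replaces $R$ by the two open halves into which $R$ is cut by the line $x_i=\tfrac12(a_i+b_i)$. For $n\ge 1$ let $C_{2,2}(n)$ be the number of distinct dyadic partitions of the unit square into $n$ rectangles, that is, of distinct sets of rectangles that are obtained by $n-1$ such steps (different sequences of steps that give the same set are not distinguished). Then for every integer $n\ge 1$ the number $C_{2,2}(n)$ is finite and $$C_{2,2}(n)=\frac1n\sum_{i=0}^{\lfloor (n-1)/3\rfloor}\binom{2(n-1-i)}{\,n-1,\;n-1-3i,\;i\,}(-1)^i\,2^{\,n-1-3i},$$ where $\binom{a+b+c}{a,\,b,\,c}=\frac{(a+b+c)!}{a!\,b!\,c!}$ is the multinomial coefficient. -/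

import Mathlib

namespace CubeDecomposition

/-- The open `d`-rectangle `(a₁, b₁) × ⋯ × (a_d, b_d)`, as a subset of `ℝ^d`. -/
def openRect {d : ℕ} (a b : Fin d → ℝ) : Set (Fin d → ℝ) :=
  Set.univ.pi fun k => Set.Ioo (a k) (b k)

/-- The endpoints `c(j) = a + (j / p) (b - a)`, `0 ≤ j ≤ p`, of the `p` equal subintervals
of the interval from `a` to `b`. -/
noncomputable def cutPoint (p : ℕ) (a b : ℝ) (j : ℕ) : ℝ :=
  a + (j : ℝ) / (p : ℝ) * (b - a)

/-- The `p`-ary decomposition, orthogonal to the `i`-th coordinate axis, of the open rectangle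
with corners `a` and `b`: the set of the `p` rectangles in which the `i`-th interval `(a i, b i)`
is replaced by `(c(j), c(j + 1))`, for `0 ≤ j < p`. -/
noncomputable def split {d : ℕ} (p : ℕ) (i : Fin d) (a b : Fin d → ℝ) :
    Set (Set (Fin d → ℝ)) :=
  Set.range fun j : Fin p =>
    openRect (Function.update a i (cutPoint p (a i) (b i) j))
      (Function.update b i (cutPoint p (a i) (b i) (j + 1)))

/-- `Reachable d p m S`: the set `S` of blocks can be obtained from `{(0,1)^d}` by `m` steps, each
of which replaces one block `R` by the members of its `p`-ary decomposition orthogonal to one of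
the axes. The endpoints `a k < b k` are determined by the nonempty block `R = openRect a b`. -/
inductive Reachable (d p : ℕ) : ℕ → Set (Set (Fin d → ℝ)) → Prop
  | zero : Reachable d p 0 {openRect (fun _ => 0) (fun _ => 1)}
  | step {m : ℕ} {S : Set (Set (Fin d → ℝ))} (hS : Reachable d p m S)
      (a b : Fin d → ℝ) (hab : ∀ k, a k < b k) (hR : openRect a b ∈ S) (i : Fin d) :
      Reachable d p (m + 1) ((S \ {openRect a b}) ∪ split p i a b)

/-- The set of all `(d, p, n)`-decompositions of the open unit `d`-cube: the sets of blocks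
reachable in `m` steps, where `n = 1 + m (p - 1)`. -/
def decompositions (d p n : ℕ) : Set (Set (Set (Fin d → ℝ))) :=
  {S | ∃ m : ℕ, n = 1 + m * (p - 1) ∧ Reachable d p m S}

/-- `C_{d,p}(n)`, the number of distinct `(d, p, n)`-decompositions. -/
noncomputable def catalanNumber (d p n : ℕ) : ℕ :=
  (decompositions d p n).ncard

end CubeDecomposition

/-! Encode a dyadic rectangle by one binary word per axis. A partition is then either the whole
square or a `join` of two partitions along its first cut. The first cut is ambiguous only when both
central lines are available; then the partition consists of independent partitions of the four
quadrants. By inclusion-exclusion the generating function satisfies `f = X + 2 f ^ 2 - f ^ 4`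
(`joins_inter_joins`, `mk_ncard_decs_two`).

This reads `f g = X` with `g = 1 - f (2 - f ^ 2)`. Lagrange inversion gives `n [X ^ n] f = [u ^ (n -
1)] (1 - u (2 - u ^ 2)) ^ (-n)`, and two binomial expansions produce the sum. The passage from real
rectangles to addresses is the injection `rect`. -/

namespace CubeDecomposition

/-- The address of a dyadic rectangle: for each axis, the word of lower (`false`) and upper (`true`)
halves chosen along that axis, outermost first. -/
abbrev Address (d : ℕ) := Fin d → List Bool

/-! ### Addresses, first cuts and the functional equation -/

namespace Address

variable {d : ℕ}

/-- The address, in the whole cube, of a rectangle with address `w` in the half `b` of the cube. -/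
def cons (i : Fin d) (b : Bool) (w : Address d) : Address d := Function.update w i (b :: w i)

/-- The address of the half `b` of a rectangle. -/
def snoc (i : Fin d) (b : Bool) (w : Address d) : Address d := Function.update w i (w i ++ [b])

/-- The address of the cube. -/
def root : Address d := fun _ => []

theorem cons_injective (i : Fin d) (b : Bool) : Function.Injective (cons i b) := by
  intro v w h
  funext k
  have hk := congrFun h k
  by_cases hki : k = i
  · subst hki; simpa [cons] using hk
  · simpa [cons, hki] using hk

theorem cons_ne_cons (i : Fin d) (v w : Address d) : cons i false v ≠ cons i true w := by
  intro h
  simpa [cons] using congrFun h i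

theorem cons_apply_self_ne_nil (i : Fin d) (b : Bool) (w : Address d) : cons i b w i ≠ [] := by
  simp [cons]

theorem cons_apply_of_ne {i j : Fin d} (h : j ≠ i) (b : Bool) (w : Address d) :
    cons i b w j = w j := by
  simp [cons, h]

theorem cons_comm {i j : Fin d} (h : i ≠ j) (b c : Bool) (w : Address d) :
    cons i b (cons j c w) = cons j c (cons i b w) := by
  rw [cons, cons, cons, cons, Function.update_of_ne h, Function.update_of_ne h.symm,
    Function.update_comm h]

theorem snoc_cons (i j : Fin d) (b c : Bool) (w : Address d) :
    snoc i b (cons j c w) = cons j c (snoc i b w) := by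
  by_cases h : i = j
  · subst h; simp [snoc, cons]
  · rw [cons, cons, snoc, snoc, Function.update_of_ne h, Function.update_of_ne (Ne.symm h),
      Function.update_comm h]

theorem snoc_root (i : Fin d) (b : Bool) : snoc i b root = cons i b root := by
  simp [snoc, cons, root]

/-- The set of addresses obtained by placing `X` in the lower half and `Y` in the upper half. -/
def join (i : Fin d) (X Y : Set (Address d)) : Set (Address d) :=
  cons i false '' X ∪ cons i true '' Y

theorem cons_false_mem_join {i : Fin d} {X Y : Set (Address d)} {w : Address d} :
    cons i false w ∈ join i X Y ↔ w ∈ X := by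
  constructor
  · rintro (⟨v, hv, h⟩ | ⟨v, -, h⟩)
    · rwa [← cons_injective i false h]
    · exact absurd h.symm (cons_ne_cons i w v)
  · exact fun h => Or.inl ⟨w, h, rfl⟩

theorem cons_true_mem_join {i : Fin d} {X Y : Set (Address d)} {w : Address d} :
    cons i true w ∈ join i X Y ↔ w ∈ Y := by
  constructor
  · rintro (⟨v, -, h⟩ | ⟨v, hv, h⟩)
    · exact absurd h (cons_ne_cons i v w)
    · rwa [← cons_injective i true h]
  · exact fun h => Or.inr ⟨w, h, rfl⟩

theorem join_inj {i : Fin d} {X Y X' Y' : Set (Address d)} (h : join i X Y = join i X' Y') :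
    X = X' ∧ Y = Y' :=
  ⟨Set.ext fun w => by rw [← cons_false_mem_join (i := i) (Y := Y), h, cons_false_mem_join],
    Set.ext fun w => by rw [← cons_true_mem_join (i := i) (X := X), h, cons_true_mem_join]⟩

/-- The four quarters cut out by two hyperplanes can be grouped along either axis first. -/
theorem join_comm {i j : Fin d} (h : i ≠ j) (A B A' B' : Set (Address d)) :
    join i (join j A B) (join j A' B') = join j (join i A A') (join i B B') := by
  simp only [join, Set.image_union, Set.image_image, cons_comm h]
  ac_rfl

theorem ncard_join (i : Fin d) {X Y : Set (Address d)} (hX : X.Finite) (hY : Y.Finite) :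
    (join i X Y).ncard = X.ncard + Y.ncard := by
  rw [join, Set.ncard_union_eq _ (hX.image _) (hY.image _),
    Set.ncard_image_of_injective _ (cons_injective i _),
    Set.ncard_image_of_injective _ (cons_injective i _)]
  rw [Set.disjoint_left]
  rintro _ ⟨v, -, rfl⟩ ⟨w, -, h⟩
  exact cons_ne_cons i v w h.symm

theorem apply_ne_nil_of_mem_join {i : Fin d} {X Y : Set (Address d)} {w : Address d}
    (h : w ∈ join i X Y) : w i ≠ [] := by
  rcases h with ⟨v, -, rfl⟩ | ⟨v, -, rfl⟩ <;> exact cons_apply_self_ne_nil i _ v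

/-- `Dec n S`: the set of addresses `S` is that of a dyadic partition of the cube into `n`
rectangles, in its recursive description by the first cut. -/
inductive Dec : ℕ → Set (Address d) → Prop
  | root : Dec 1 {root}
  | join {m n : ℕ} {X Y : Set (Address d)} (i : Fin d) (hX : Dec m X) (hY : Dec n Y) :
      Dec (m + n) (join i X Y)

namespace Dec

variable {n : ℕ} {S : Set (Address d)}

theorem pos (h : Dec n S) : 0 < n := by
  induction h <;> omega

theorem finite (h : Dec n S) : S.Finite := by
  induction h with
  | root => exact Set.finite_singleton _
  | join i _ _ hX hY => exact (hX.image _).union (hY.image _)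

theorem ncard_eq (h : Dec n S) : S.ncard = n := by
  induction h with
  | root => exact Set.ncard_singleton _
  | join i hX hY ihX ihY => rw [ncard_join i hX.finite hY.finite, ihX, ihY]

theorem length_lt (h : Dec n S) : ∀ w ∈ S, ∀ k, (w k).length < n := by
  induction h with
  | root => rintro w rfl k; simp [Address.root]
  | @join m n X Y i hX hY ihX ihY =>
    have := hX.pos
    have := hY.pos
    rintro _ (⟨w, hw, rfl⟩ | ⟨w, hw, rfl⟩) k
    · have := ihX w hw k
      by_cases hk : k = i
      · subst hk; simp [cons]; omega
      · rw [cons_apply_of_ne hk]; omega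
    · have := ihY w hw k
      by_cases hk : k = i
      · subst hk; simp [cons]; omega
      · rw [cons_apply_of_ne hk]; omega

/-- A further cut happens inside one half of the first cut, because `snoc` acts at the end of a word
and so commutes with `cons`. -/
theorem split (h : Dec n S) (i : Fin d) :
    ∀ w ∈ S, Dec (n + 1) (S \ {w} ∪ {snoc i false w, snoc i true w}) := by
  induction h with
  | root =>
    rintro w rfl
    convert Dec.join i Dec.root Dec.root using 1
    simp [Address.join, snoc_root, Set.pair_comm]
  | @join m n X Y j hX hY ihX ihY =>
    rintro _ (⟨w, hw, rfl⟩ | ⟨w, hw, rfl⟩)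
    · convert Dec.join j (ihX w hw) hY using 1
      · omega
      · simp only [Address.join, snoc_cons, Set.image_union, Set.image_pair, Set.union_sdiff_distrib,
          Set.image_sdiff (cons_injective j false), Set.image_singleton]
        rw [Set.sdiff_singleton_eq_self (s := cons j true '' Y)]
        · ac_rfl
        · rintro ⟨v, -, h⟩
          exact cons_ne_cons j w v h.symm
    · rw [add_assoc]
      convert Dec.join j hX (ihY w hw) using 1
      simp only [Address.join, snoc_cons, Set.image_union, Set.image_pair, Set.union_sdiff_distrib,
        Set.image_sdiff (cons_injective j true), Set.image_singleton]
      rw [Set.sdiff_singleton_eq_self (s := cons j false '' X)]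
      · ac_rfl
      · rintro ⟨v, -, h⟩
        exact cons_ne_cons j v w h

end Dec

/-- `Steps m S`: the set of addresses `S` is obtained from that of the cube by halving `m` times
one of its rectangles. -/
inductive Steps : ℕ → Set (Address d) → Prop
  | zero : Steps 0 {root}
  | step {m : ℕ} {S : Set (Address d)} (hS : Steps m S) {w : Address d} (hw : w ∈ S) (i : Fin d) :
      Steps (m + 1) (S \ {w} ∪ {snoc i false w, snoc i true w})

theorem Steps.dec {m : ℕ} {S : Set (Address d)} (h : Steps m S) : Dec (m + 1) S := by
  induction h with
  | zero => exact Dec.root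
  | step _ hw i ih => exact ih.split i _ hw

/-- Cut the cube first, then replay the steps of `X` in the lower half. `Steps.join` afterwards
replays those of `Y` in the upper half. -/
theorem Steps.join_root {m : ℕ} {X : Set (Address d)} (i : Fin d) (h : Steps m X) :
    Steps (m + 1) (join i X {root}) := by
  induction h with
  | zero =>
    convert Steps.step Steps.zero (Set.mem_singleton (root : Address d)) i using 1
    simp [Address.join, snoc_root, Set.pair_comm]
  | @step m X hX w hw j ih =>
    convert Steps.step ih (cons_false_mem_join.2 hw) j using 1
    simp only [join, snoc_cons, Set.image_union, Set.image_pair, Set.union_sdiff_distrib,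
      Set.image_sdiff (cons_injective i false), Set.image_singleton]
    rw [Set.sdiff_singleton_eq_self (s := {cons i true root})]
    · ac_rfl
    · rintro h
      exact cons_ne_cons i _ _ h

theorem Steps.join {m k : ℕ} {X Y : Set (Address d)} (i : Fin d) (hX : Steps m X)
    (hY : Steps k Y) : Steps (m + k + 1) (join i X Y) := by
  induction hY with
  | zero => exact hX.join_root i
  | @step k Y hY w hw j ih =>
    rw [← add_assoc]
    convert Steps.step ih (cons_true_mem_join.2 hw) j using 1
    simp only [Address.join, snoc_cons, Set.image_union, Set.image_pair, Set.union_sdiff_distrib,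
      Set.image_sdiff (cons_injective i true), Set.image_singleton]
    rw [Set.sdiff_singleton_eq_self (s := cons i false '' X)]
    · ac_rfl
    · rintro ⟨v, -, h⟩
      exact cons_ne_cons i _ _ h

theorem Dec.steps {n : ℕ} {S : Set (Address d)} (h : Dec n S) : Steps (n - 1) S := by
  induction h with
  | root => exact Steps.zero
  | @join m n X Y i hX hY ihX ihY =>
    have := hX.pos
    have := hY.pos
    convert ihX.join i ihY using 1
    omega

/-- The sets `join i X Y` with `X` in the family `A`, `Y` in the family `B` and total grade `n`. -/
def joins (i : Fin d) (A B : ℕ → Set (Set (Address d))) (n : ℕ) : Set (Set (Address d)) :=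
  {S | ∃ a b, a + b = n ∧ ∃ X ∈ A a, ∃ Y ∈ B b, join i X Y = S}

theorem joins_eq_biUnion (i : Fin d) (A B : ℕ → Set (Set (Address d))) (n : ℕ) :
    joins i A B n = (fun p : Set (Address d) × Set (Address d) => join i p.1 p.2) ''
      ⋃ p ∈ Finset.HasAntidiagonal.antidiagonal n, A p.1 ×ˢ B p.2 := by
  ext S
  simp only [joins, Set.mem_ofPred_eq, Set.mem_image, Set.mem_iUnion, Prod.exists,
    Finset.HasAntidiagonal.mem_antidiagonal, Set.mem_prod]
  constructor
  · rintro ⟨a, b, h, X, hX, Y, hY, rfl⟩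
    exact ⟨X, Y, ⟨a, b, h, hX, hY⟩, rfl⟩
  · rintro ⟨X, Y, ⟨a, b, h, hX, hY⟩, rfl⟩
    exact ⟨a, b, h, X, hX, Y, hY, rfl⟩

theorem ncard_joins (i : Fin d) {A B : ℕ → Set (Set (Address d))} (hA : ∀ n, (A n).Finite)
    (hB : ∀ n, (B n).Finite) (hA' : ∀ n, ∀ X ∈ A n, X.ncard = n)
    (hB' : ∀ n, ∀ X ∈ B n, X.ncard = n) (n : ℕ) :
    (joins i A B n).ncard = ∑ p ∈ Finset.HasAntidiagonal.antidiagonal n, (A p.1).ncard * (B p.2).ncard := by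
  classical
  rw [joins_eq_biUnion, Set.ncard_image_of_injective]
  · have : (⋃ p ∈ Finset.HasAntidiagonal.antidiagonal n, A p.1 ×ˢ B p.2) =
        ↑((Finset.HasAntidiagonal.antidiagonal n).biUnion fun p => (hA p.1).toFinset ×ˢ (hB p.2).toFinset) := by
      simp
    rw [this, Set.ncard_coe_finset, Finset.card_biUnion]
    · refine Finset.sum_congr rfl fun p _ => ?_
      rw [Finset.card_product, Set.ncard_eq_toFinset_card _ (hA _),
        Set.ncard_eq_toFinset_card _ (hB _)]
    -- The grade of a member is its cardinality, so different pairs of grades give disjoint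
    -- products.
    · intro p _ q _ hpq
      refine Finset.disjoint_left.2 ?_
      rintro ⟨X, Y⟩ h h'
      simp only [Finset.mem_product, Set.Finite.mem_toFinset] at h h'
      exact hpq (Prod.ext ((hA' _ _ h.1).symm.trans (hA' _ _ h'.1))
        ((hB' _ _ h.2).symm.trans (hB' _ _ h'.2)))
  · rintro ⟨X, Y⟩ ⟨X', Y'⟩ h
    exact Prod.ext (join_inj h).1 (join_inj h).2

variable (d) in
/-- The address sets of the dyadic partitions of the cube into `n` rectangles. -/
def decs (n : ℕ) : Set (Set (Address d)) := {S | Dec n S}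

theorem finite_decs (n : ℕ) : (decs d n).Finite := by
  have hfin : {w : Address d | ∀ k, (w k).length < n}.Finite := by
    have := Set.Finite.pi' (fun _ : Fin d => List.finite_length_lt Bool n)
    simpa using this
  exact hfin.finite_subsets.subset fun S hS w hw => hS.length_lt w hw

theorem joins_decs_subset (i : Fin d) (n : ℕ) : joins i (decs d) (decs d) n ⊆ decs d n := by
  rintro _ ⟨a, b, rfl, X, hX, Y, hY, rfl⟩
  exact Dec.join i hX hY

/-- A partition none of whose rectangles crosses the central hyperplane orthogonal to the `i`-th
axis can be obtained by cutting first along this hyperplane. -/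
theorem Dec.mem_joins {n : ℕ} {S : Set (Address d)} (h : Dec n S) (i : Fin d) :
    (∀ w ∈ S, w i ≠ []) → S ∈ joins i (decs d) (decs d) n := by
  induction h with
  | root => exact fun h => absurd rfl (h _ rfl)
  | @join m n X Y j hX hY ihX ihY =>
    intro h
    by_cases hij : i = j
    · subst hij
      exact ⟨m, n, rfl, X, hX, Y, hY, rfl⟩
    -- As `i ≠ j`, both halves also avoid the hyperplane orthogonal to `i`, hence can be cut along
    -- it; `join_comm` then swaps the two levels.
    · obtain ⟨a, b, rfl, P, hP, Q, hQ, rfl⟩ := ihX fun w hw => by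
        simpa [cons_apply_of_ne hij] using h _ (cons_false_mem_join.2 hw)
      obtain ⟨a', b', rfl, P', hP', Q', hQ', rfl⟩ := ihY fun w hw => by
        simpa [cons_apply_of_ne hij] using h _ (cons_true_mem_join.2 hw)
      exact ⟨a + a', b + b', by omega, _, Dec.join j hP hP', _, Dec.join j hQ hQ',
        join_comm hij _ _ _ _⟩

/-- Cutting along `i` leaves the `j`-words unchanged, so `j` is a possible first cut of the whole
exactly when it is one of each half. -/
theorem joins_inter_joins {i j : Fin d} (hij : i ≠ j) (n : ℕ) :
    joins i (decs d) (decs d) n ∩ joins j (decs d) (decs d) n =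
      joins i (joins j (decs d) (decs d)) (joins j (decs d) (decs d)) n := by
  ext S
  constructor
  · rintro ⟨⟨a, b, hab, X, hX, Y, hY, rfl⟩, ⟨a', b', -, P, -, Q, -, h⟩⟩
    have hne : ∀ w ∈ join i X Y, w j ≠ [] := fun w hw => apply_ne_nil_of_mem_join (h ▸ hw)
    refine ⟨a, b, hab, X, hX.mem_joins j fun w hw => ?_, Y, hY.mem_joins j fun w hw => ?_, rfl⟩
    · simpa [cons_apply_of_ne hij.symm] using hne _ (cons_false_mem_join.2 hw)
    · simpa [cons_apply_of_ne hij.symm] using hne _ (cons_true_mem_join.2 hw)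
  · rintro ⟨a, b, rfl, X, hX, Y, hY, rfl⟩
    refine ⟨⟨a, b, rfl, X, joins_decs_subset j a hX, Y, joins_decs_subset j b hY, rfl⟩, ?_⟩
    obtain ⟨a, b, rfl, P, hP, Q, hQ, rfl⟩ := hX
    obtain ⟨a', b', rfl, P', hP', Q', hQ', rfl⟩ := hY
    exact ⟨a + a', b + b', by omega, _, Dec.join i hP hP', _, Dec.join i hQ hQ',
      join_comm hij.symm _ _ _ _⟩

theorem decs_two_eq (n : ℕ) :
    decs 2 n = {S | n = 1 ∧ S = {root}} ∪
      (joins 0 (decs 2) (decs 2) n ∪ joins 1 (decs 2) (decs 2) n) := by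
  ext S
  constructor
  · intro h
    cases h with
    | root => exact Or.inl ⟨rfl, rfl⟩
    | @join m n X Y i hX hY =>
      right
      fin_cases i
      · exact Or.inl ⟨m, n, rfl, X, hX, Y, hY, rfl⟩
      · exact Or.inr ⟨m, n, rfl, X, hX, Y, hY, rfl⟩
  · rintro (⟨rfl, rfl⟩ | h | h)
    · exact Dec.root
    · exact joins_decs_subset _ _ h
    · exact joins_decs_subset _ _ h

open PowerSeries in
/-- The functional equation of the generating function of dyadic partitions of the square. -/
theorem mk_ncard_decs_two {f : ℚ⟦X⟧} (hf : f = mk fun n => ((decs 2 n).ncard : ℚ)) :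
    f + f ^ 4 = X + 2 * f ^ 2 := by
  have hcard : ∀ n, ∀ S ∈ decs 2 n, S.ncard = n := fun n S hS => hS.ncard_eq
  have hfin (i : Fin 2) (n : ℕ) : (joins i (decs 2) (decs 2) n).Finite :=
    (finite_decs n).subset (joins_decs_subset i n)
  have hsq (i : Fin 2) (n : ℕ) : ((joins i (decs 2) (decs 2) n).ncard : ℚ) = coeff n (f ^ 2) := by
    rw [ncard_joins i finite_decs finite_decs hcard hcard, sq, coeff_mul, hf]
    simp
  ext n
  have hfour : ((joins 0 (decs 2) (decs 2) n ∩ joins 1 (decs 2) (decs 2) n).ncard : ℚ) =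
      coeff n (f ^ 4) := by
    rw [joins_inter_joins (by decide), ncard_joins 0 (hfin 1) (hfin 1)
      (fun n S hS => hcard n S (joins_decs_subset 1 n hS))
      (fun n S hS => hcard n S (joins_decs_subset 1 n hS)),
      show f ^ 4 = f ^ 2 * f ^ 2 by ring, coeff_mul]
    simp [hsq]
  have hunion : ((joins 0 (decs 2) (decs 2) n ∪ joins 1 (decs 2) (decs 2) n).ncard : ℚ) +
      coeff n (f ^ 4) = 2 * coeff n (f ^ 2) := by
    rw [← hfour, two_mul]
    nth_rewrite 1 [← hsq 0 n]
    rw [← hsq 1 n]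
    exact_mod_cast Set.ncard_union_add_ncard_inter _ _ (hfin 0 n) (hfin 1 n)
  have hX : ({S : Set (Address 2) | n = 1 ∧ S = {root}}.ncard : ℚ) = coeff n (X : ℚ⟦X⟧) := by
    rw [coeff_X]
    split_ifs with h <;> simp [h]
  have htotal : coeff n f = coeff n (X : ℚ⟦X⟧) +
      ((joins 0 (decs 2) (decs 2) n ∪ joins 1 (decs 2) (decs 2) n).ncard : ℚ) := by
    rw [hf, coeff_mk, ← hX, ← Nat.cast_add]
    conv_lhs => rw [decs_two_eq]
    rw [Set.ncard_union_eq _ _ ((hfin 0 n).union (hfin 1 n))]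
    · rw [Set.disjoint_left]
      rintro S ⟨-, rfl⟩ (⟨_, _, _, _, _, _, _, h⟩ | ⟨_, _, _, _, _, _, _, h⟩)
      · exact apply_ne_nil_of_mem_join (h ▸ Set.mem_singleton root) rfl
      · exact apply_ne_nil_of_mem_join (h ▸ Set.mem_singleton root) rfl
    · exact (Set.finite_singleton {root}).subset fun S hS => hS.2
  rw [map_add, map_add, htotal, add_assoc, hunion, show (2 : ℚ⟦X⟧) = C 2 from rfl, coeff_C_mul]

end Address

end CubeDecomposition

/-! ### From real rectangles to addresses -/

namespace CubeDecomposition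

/-- A nonempty box projects onto its intervals, whose endpoints are their infimum and supremum. -/
theorem openRect_inj {d : ℕ} {a b a' b' : Fin d → ℝ} (hab : ∀ k, a k < b k)
    (h : openRect a b = openRect a' b') : a = a' ∧ b = b' := by
  have hne : (openRect a b).Nonempty :=
    Set.univ_pi_nonempty_iff.2 fun k => Set.nonempty_Ioo.2 (hab k)
  have hab' : ∀ k, a' k < b' k := fun k =>
    Set.nonempty_Ioo.1 (Set.univ_pi_nonempty_iff.1 (h ▸ hne) k)
  have hI (k : Fin d) : Set.Ioo (a k) (b k) = Set.Ioo (a' k) (b' k) := by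
    have h₁ := Set.eval_image_univ_pi (t := fun k => Set.Ioo (a k) (b k)) (i := k) hne
    have h₂ := Set.eval_image_univ_pi (t := fun k => Set.Ioo (a' k) (b' k)) (i := k)
      (show (openRect a' b').Nonempty from h ▸ hne)
    exact h₁.symm.trans ((congrArg _ h).trans h₂)
  constructor
  · funext k
    rw [← csInf_Ioo (hab k), hI, csInf_Ioo (hab' k)]
  · funext k
    rw [← csSup_Ioo (hab k), hI, csSup_Ioo (hab' k)]

namespace Address

/-- The lower endpoint of the dyadic subinterval of `(0, 1)` with address `u`. -/
noncomputable def lower : List Bool → ℝ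
  | [] => 0
  | b :: u => (cond b 1 0 + lower u) / 2

/-- The upper endpoint of the dyadic subinterval of `(0, 1)` with address `u`. -/
noncomputable def upper : List Bool → ℝ
  | [] => 1
  | b :: u => (cond b 1 0 + upper u) / 2

theorem lower_lt_upper (u : List Bool) : lower u < upper u := by
  induction u with
  | nil => simp [lower, upper]
  | cons b u ih => simp only [lower, upper]; linarith

theorem lower_nonneg (u : List Bool) : 0 ≤ lower u := by
  induction u with
  | nil => simp [lower]
  | cons b u ih => cases b <;> simp only [lower, cond] <;> linarith

theorem upper_le_one (u : List Bool) : upper u ≤ 1 := by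
  induction u with
  | nil => simp [upper]
  | cons b u ih => cases b <;> simp only [upper, cond] <;> linarith

/-- The side of `1 / 2` on which the interval lies determines the first letter; only the empty word
gives an interval reaching both `0` and `1`. -/
theorem lower_upper_inj : ∀ {u v : List Bool}, lower u = lower v → upper u = upper v → u = v
  | [], [], _, _ => rfl
  | [], b :: v, h, h' => by
    have := lower_nonneg v
    have := upper_le_one v
    cases b <;> simp only [lower, upper, cond] at h h' <;> linarith
  | b :: u, [], h, h' => by
    have := lower_nonneg u
    have := upper_le_one u
    cases b <;> simp only [lower, upper, cond] at h h' <;> linarith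
  | b :: u, c :: v, h, h' => by
    have := lower_nonneg u
    have := upper_le_one u
    have := lower_nonneg v
    have := upper_le_one v
    have := lower_lt_upper u
    have := lower_lt_upper v
    cases b <;> cases c <;> simp only [lower, upper, cond] at h h'
    · rw [lower_upper_inj (u := u) (v := v) (by linarith) (by linarith)]
    · linarith
    · linarith
    · rw [lower_upper_inj (u := u) (v := v) (by linarith) (by linarith)]

theorem lower_append_false (u : List Bool) : lower (u ++ [false]) = lower u := by
  induction u with
  | nil => simp [lower]
  | cons b u ih => simp only [List.cons_append, lower, ih]

theorem upper_append_true (u : List Bool) : upper (u ++ [true]) = upper u := by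
  induction u with
  | nil => simp [upper]
  | cons b u ih => simp only [List.cons_append, upper, ih]

theorem upper_append_false (u : List Bool) :
    upper (u ++ [false]) = (lower u + upper u) / 2 := by
  induction u with
  | nil => simp [lower, upper]
  | cons b u ih => simp only [List.cons_append, upper, lower, ih]; ring

theorem lower_append_true (u : List Bool) :
    lower (u ++ [true]) = (lower u + upper u) / 2 := by
  induction u with
  | nil => simp [lower, upper]
  | cons b u ih => simp only [List.cons_append, upper, lower, ih]; ring

variable {d : ℕ}

/-- The open rectangle with address `w`. -/
noncomputable def rect (w : Address d) : Set (Fin d → ℝ) :=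
  openRect (fun k => lower (w k)) (fun k => upper (w k))

theorem rect_injective : Function.Injective (rect (d := d)) := by
  intro v w h
  obtain ⟨h₁, h₂⟩ := openRect_inj (fun k => lower_lt_upper (v k)) h
  exact funext fun k => lower_upper_inj (congrFun h₁ k) (congrFun h₂ k)

theorem rect_root : rect (root : Address d) = openRect (fun _ => 0) (fun _ => 1) := rfl

theorem rect_snoc (i : Fin d) (c : Bool) (w : Address d) :
    rect (snoc i c w) = openRect (Function.update (fun k => lower (w k)) i (lower (w i ++ [c])))
      (Function.update (fun k => upper (w k)) i (upper (w i ++ [c]))) := by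
  unfold rect snoc
  congr 1
  · funext k
    exact Function.apply_update (fun _ => lower) w i _ k
  · funext k
    exact Function.apply_update (fun _ => upper) w i _ k

theorem split_rect (i : Fin d) (w : Address d) :
    split 2 i (fun k => lower (w k)) (fun k => upper (w k)) =
      rect '' {snoc i false w, snoc i true w} := by
  have hmid (x y : ℝ) : x + 1 / 2 * (y - x) = (x + y) / 2 := by ring
  rw [Set.image_pair, rect_snoc, rect_snoc, lower_append_false, upper_append_false,
    lower_append_true, upper_append_true]
  ext R
  simp only [split, Set.mem_range, Fin.exists_fin_two, Set.mem_insert_iff, Set.mem_singleton_iff,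
    cutPoint]
  simp [hmid, eq_comm, -one_div]

theorem reachable_iff {m : ℕ} {S : Set (Set (Fin d → ℝ))} :
    Reachable d 2 m S ↔ ∃ T, Steps m T ∧ rect '' T = S := by
  constructor
  · intro h
    induction h with
    | zero => exact ⟨_, Steps.zero, by rw [Set.image_singleton, rect_root]⟩
    | step hS a b hab hR i ih =>
      obtain ⟨T, hT, rfl⟩ := ih
      obtain ⟨w, hw, hwR⟩ := hR
      -- The corners of the chosen block are a priori arbitrary reals; they must be the dyadic
      -- endpoints of `w`.
      obtain ⟨rfl, rfl⟩ := openRect_inj hab hwR.symm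
      refine ⟨_, Steps.step hT hw i, ?_⟩
      rw [Set.image_union, Set.image_sdiff rect_injective, Set.image_singleton, split_rect]
      rfl
  · rintro ⟨T, hT, rfl⟩
    induction hT with
    | zero => rw [Set.image_singleton, rect_root]; exact Reachable.zero
    | @step m T hT w hw i ih =>
      rw [Set.image_union, Set.image_sdiff rect_injective, Set.image_singleton, ← split_rect]
      exact Reachable.step ih _ _ (fun k => lower_lt_upper (w k)) ⟨w, hw, rfl⟩ i

theorem decompositions_eq {n : ℕ} (hn : 1 ≤ n) :
    decompositions d 2 n = (fun T => rect '' T) '' decs d n := by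
  ext S
  constructor
  · rintro ⟨m, rfl, hS⟩
    obtain ⟨T, hT, rfl⟩ := reachable_iff.1 hS
    exact ⟨T, by simpa [add_comm, decs] using hT.dec, rfl⟩
  · rintro ⟨T, hT, rfl⟩
    exact ⟨n - 1, by omega, reachable_iff.2 ⟨T, hT.steps, rfl⟩⟩

theorem finite_decompositions {n : ℕ} (hn : 1 ≤ n) : (decompositions d 2 n).Finite := by
  rw [decompositions_eq hn]
  exact (finite_decs n).image _

theorem catalanNumber_eq {n : ℕ} (hn : 1 ≤ n) : catalanNumber d 2 n = (decs d n).ncard := by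
  rw [catalanNumber, decompositions_eq hn]
  exact Set.ncard_image_of_injective _ rect_injective.image_injective

end Address

end CubeDecomposition

/-! ### Lagrange inversion and the closed formula -/

namespace CubeDecomposition

open PowerSeries

/-- The partial sums of the series of `(1 - u) ^ (-(N + 1))` invert `(1 - u) ^ (N + 1)` modulo
`u ^ (N + 1)`. -/
theorem exists_sum_choose_mul_one_sub_pow {R : Type*} [CommRing R] (N : ℕ) (u : R) :
    ∃ r, (∑ k ∈ Finset.range (N + 1), ((N + k).choose N : R) * u ^ k) * (1 - u) ^ (N + 1) =
      1 + u ^ (N + 1) * r := by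
  let P : Polynomial R := trunc (N + 1) (mk fun k => ((N + k).choose N : R))
  have hP : P.eval u = ∑ k ∈ Finset.range (N + 1), ((N + k).choose N : R) * u ^ k := by
    rw [Polynomial.eval, eval₂_trunc_eq_sum_range]
    simp
  -- Coefficients of index at most `N` do not see the truncation. A polynomial divisibility, unlike
  -- a power series identity, can be evaluated at any `u`.
  have hdvd : (Polynomial.X : Polynomial R) ^ (N + 1) ∣ P * (1 - Polynomial.X) ^ (N + 1) - 1 := by
    rw [Polynomial.X_pow_dvd_iff]
    intro k hk
    rw [← Polynomial.coeff_coe, Polynomial.coe_sub, Polynomial.coe_mul, Polynomial.coe_pow,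
      Polynomial.coe_sub, Polynomial.coe_one, Polynomial.coe_X, map_sub (coeff k), sub_eq_zero]
    nth_rewrite 2 [← mk_add_choose_mul_one_sub_pow_eq_one R N]
    rw [coeff_mul, coeff_mul]
    refine Finset.sum_congr rfl fun p hp => ?_
    have := Finset.HasAntidiagonal.mem_antidiagonal.1 hp
    rw [Polynomial.coeff_coe, coeff_trunc, if_pos (by omega)]
  obtain ⟨r, hr⟩ := hdvd
  refine ⟨r.eval u, ?_⟩
  rw [← hP]
  have := congrArg (Polynomial.eval u) hr
  simp only [Polynomial.eval_sub, Polynomial.eval_mul, Polynomial.eval_pow, Polynomial.eval_one,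
    Polynomial.eval_X] at this
  linear_combination this

section Lagrange

variable {f g : ℚ⟦X⟧}

/-- Since `g = X / f`, this is the residue of `f' / f ^ (k + 1)`: it is `1` for the logarithmic
derivative, and `0` for `k > 0`, where the quotient is itself a derivative. The proof avoids Laurent
series. -/
theorem coeff_pow_mul_derivative (h : f * g = X) (hf : constantCoeff f = 0) (k : ℕ) :
    coeff k (g ^ (k + 1) * d⁄dX ℚ f) = if k = 0 then 1 else 0 := by
  have hd : d⁄dX ℚ f * g = 1 - f * d⁄dX ℚ g := by
    have := congrArg (d⁄dX ℚ) h
    rw [Derivation.leibniz, derivative_X, smul_eq_mul, smul_eq_mul] at this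
    linear_combination this
  have hk : g ^ (k + 1) * d⁄dX ℚ f = g ^ k - f * (g ^ k * d⁄dX ℚ g) := by
    linear_combination g ^ k * hd
  rw [hk]
  cases k with
  | zero => simp [hf]
  | succ j =>
    have hj : coeff j (g ^ j * d⁄dX ℚ g) = coeff (j + 1) (g ^ (j + 1)) := by
      have := coeff_derivative (g ^ (j + 1)) j
      rw [derivative_pow, Nat.add_sub_cancel, mul_assoc, ← map_natCast (C (R := ℚ)),
        coeff_C_mul] at this
      have hne : ((j : ℚ) + 1) ≠ 0 := by positivity
      apply mul_left_cancel₀ hne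
      rw [← Nat.cast_succ, this]
      push_cast
      ring
    rw [show f * (g ^ (j + 1) * d⁄dX ℚ g) = X * (g ^ j * d⁄dX ℚ g) by rw [← h]; ring, map_sub,
      coeff_succ_X_mul, hj]
    simp

theorem coeff_pow_mul_pow_mul_derivative (h : f * g = X) (hf : constantCoeff f = 0) (N e : ℕ) :
    coeff N (f ^ e * (g ^ (N + 1) * d⁄dX ℚ f)) = if e = N then 1 else 0 := by
  rcases le_or_gt e N with he | he
  · obtain ⟨k, rfl⟩ := Nat.exists_eq_add_of_le he
    rw [show f ^ e * (g ^ (e + k + 1) * d⁄dX ℚ f) = X ^ e * (g ^ (k + 1) * d⁄dX ℚ f) by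
      rw [← h]; ring, add_comm e k, coeff_X_pow_mul, coeff_pow_mul_derivative h hf]
    simp
  · rw [if_neg he.ne']
    have hX : (X : ℚ⟦X⟧) ^ e ∣ f ^ e * (g ^ (N + 1) * d⁄dX ℚ f) :=
      (pow_dvd_pow_of_dvd (X_dvd_iff.2 hf) e).mul_right _
    exact X_pow_dvd_iff.1 hX N he

/-- Lagrange inversion for the equation `f (1 - 2 f + f ^ 3) = X`. -/
theorem coeff_of_functional_equation (h : f + f ^ 4 = X + 2 * f ^ 2) (hf : constantCoeff f = 0)
    (N : ℕ) :
    ((N : ℚ) + 1) * coeff (N + 1) f = ∑ k ∈ Finset.range (N + 1), ∑ i ∈ Finset.range (k + 1),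
      if k + 2 * i = N then
        ((N + k).choose N : ℚ) * k.choose i * (-1) ^ i * 2 ^ (k - i) else 0 := by
  have hg : f * (1 - f * (2 - f ^ 2)) = X := by linear_combination h
  obtain ⟨r, hr⟩ := exists_sum_choose_mul_one_sub_pow N (f * (2 - f ^ 2))
  set g := 1 - f * (2 - f ^ 2)
  have hcoeff := coeff_pow_mul_pow_mul_derivative hg hf N
  have hexp (k : ℕ) : (f * (2 - f ^ 2)) ^ k = ∑ i ∈ Finset.range (k + 1),
      C ((k.choose i : ℚ) * (-1) ^ i * 2 ^ (k - i)) * f ^ (k + 2 * i) := by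
    rw [mul_pow, sub_eq_neg_add, add_pow, Finset.mul_sum]
    refine Finset.sum_congr rfl fun i _ => ?_
    have h2 : (C 2 : ℚ⟦X⟧) = 2 := rfl
    simp only [map_mul, map_pow, map_neg, map_one, map_natCast, h2]
    rw [neg_pow (f ^ 2)]
    ring
  have hzero : coeff N ((f * (2 - f ^ 2)) ^ (N + 1) * r * d⁄dX ℚ f) = 0 := by
    have hX : (X : ℚ⟦X⟧) ^ (N + 1) ∣ (f * (2 - f ^ 2)) ^ (N + 1) * r * d⁄dX ℚ f :=
      ((pow_dvd_pow_of_dvd ((X_dvd_iff.2 hf).mul_right _) _).mul_right _).mul_right _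
    exact X_pow_dvd_iff.1 hX N N.lt_succ_self
  -- Modulo `X ^ (N + 1)` the inserted factor is `1`, because `g = 1 - u` with `u = f * (2 - f ^ 2)`
  -- divisible by `X`. The residue lemma then keeps only the terms with `f ^ N`.
  have key : coeff N (d⁄dX ℚ f) = coeff N ((∑ k ∈ Finset.range (N + 1),
      ((N + k).choose N : ℚ⟦X⟧) * (f * (2 - f ^ 2)) ^ k) * (g ^ (N + 1) * d⁄dX ℚ f)) := by
    rw [← mul_assoc, hr, add_mul, one_mul, map_add, hzero, add_zero]
  rw [mul_comm, ← coeff_derivative, key, Finset.sum_mul, map_sum]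
  refine Finset.sum_congr rfl fun k _ => ?_
  rw [hexp, Finset.mul_sum, Finset.sum_mul, map_sum]
  refine Finset.sum_congr rfl fun i _ => ?_
  rw [← map_natCast (C (R := ℚ)), ← mul_assoc (C _), ← map_mul, mul_assoc, coeff_C_mul, hcoeff]
  split_ifs <;> ring

end Lagrange

/-- With `j = k - i = N - 3 * i`, both sides are `(N + j + i)! / (N! j! i!)`. -/
theorem choose_mul_choose_eq_multinomial {N k i : ℕ} (h : k + 2 * i = N) (hi : i ≤ k) :
    (N + k).choose N * k.choose i = Nat.multinomial Finset.univ ![N, N - 3 * i, i] := by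
  obtain ⟨j, rfl⟩ := Nat.exists_eq_add_of_le hi
  have hj : N - 3 * i = j := by omega
  have h₁ := Nat.add_choose_mul_factorial_mul_factorial N (i + j)
  have h₂ := Nat.add_choose_mul_factorial_mul_factorial i j
  have h₃ := Nat.multinomial_spec Finset.univ ![N, j, i]
  simp only [Fin.prod_univ_three, Fin.sum_univ_three, Matrix.cons_val_zero, Matrix.cons_val_one,
    Matrix.cons_val] at h₃
  rw [hj]
  have hpos : 0 < N.factorial * j.factorial * i.factorial := by positivity
  apply Nat.eq_of_mul_eq_mul_left hpos
  rw [h₃, show N + j + i = N + (i + j) by ring, ← h₁, ← h₂, Nat.choose_symm_add (a := N),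
    Nat.choose_symm_add (a := i)]
  ring

theorem sum_eq_sum_multinomial (N : ℕ) :
    (∑ k ∈ Finset.range (N + 1), ∑ i ∈ Finset.range (k + 1),
      if k + 2 * i = N then
        ((N + k).choose N : ℚ) * k.choose i * (-1) ^ i * 2 ^ (k - i) else 0) =
    ∑ i ∈ Finset.Icc 0 (N / 3), (Nat.multinomial Finset.univ ![N, N - 3 * i, i] : ℚ) *
      (-1) ^ i * 2 ^ (N - 3 * i) := by
  rw [Finset.sum_sigma', ← Finset.sum_filter]
  -- The condition forces `k = N - 2 * i`, and `i ≤ k` becomes `3 * i ≤ N`.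
  refine Finset.sum_bij' (fun p _ => p.2) (fun i _ => ⟨N - 2 * i, i⟩) ?_ ?_ ?_ ?_ ?_
  · rintro ⟨k, i⟩ h
    simp at h ⊢
    omega
  · intro i h
    simp at h ⊢
    omega
  · rintro ⟨k, i⟩ h
    simp at h ⊢
    omega
  · intro i h
    rfl
  · rintro ⟨k, i⟩ h
    simp at h
    rw [← choose_mul_choose_eq_multinomial h.2 (by omega), show N - 3 * i = k - i by omega]
    push_cast
    ring

end CubeDecomposition

theorem corollary5 (n : ℕ) (hn : 1 ≤ n) :
    (CubeDecomposition.decompositions 2 2 n).Finite ∧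
      (CubeDecomposition.catalanNumber 2 2 n : ℚ) =
        (1 / (n : ℚ)) * ∑ i ∈ Finset.Icc 0 ((n - 1) / 3),
          (Nat.multinomial Finset.univ ![n - 1, n - 1 - 3 * i, i] : ℚ) *
            (-1) ^ i * 2 ^ (n - 1 - 3 * i) := by
  refine ⟨CubeDecomposition.Address.finite_decompositions hn, ?_⟩
  obtain ⟨N, rfl⟩ := Nat.exists_eq_add_of_le' hn
  have hzero : CubeDecomposition.Address.decs 2 0 = ∅ :=
    Set.eq_empty_of_forall_notMem fun S hS => hS.pos.ne rfl
  have key := CubeDecomposition.coeff_of_functional_equation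
    (CubeDecomposition.Address.mk_ncard_decs_two rfl) (by simp [hzero]) N
  rw [CubeDecomposition.sum_eq_sum_multinomial, PowerSeries.coeff_mk] at key
  rw [CubeDecomposition.Address.catalanNumber_eq hn, Nat.add_sub_cancel, ← key]
  have hne : ((N : ℚ) + 1) ≠ 0 := by positivity
  push_cast
  field_simp
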